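/- **Setting.** Let $AP$ be a finite set of atomic propositions. A trace is an infinite word $w$ over $2^{AP}$. Formulas are interpreted at intervals $[i,j]$ ($i\le j$) of $\mathbb N$, of length $|[i,j]|=j-i+1$; a proposition $p$ holds over $[i,j]$ iff $p\in w(h)$ for all $h\in[i,j]$. The modality $\langle A\rangle$ (resp. $[A]$) quantifies existentially (resp. universally) over the intervals $[j,k]$, $k\ge j$, and $\langle B\rangle$, $[B]$ over the proper prefixes $[i,k]$, $i\le k<j$. $\mathsf{AB}$ formulas are built from $\top$ and propositions with Boolean connectives and the modalities $\langle A\rangle,\langle B\rangle$. $\mathsf{P}(\mathsf{AB})$ formulas are built in positive normal form from $\top$, $\neg\top$ and literals $p,\neg p$ with $\vee,\wedge$, the modalities $\langle X\rangle,[X]$ ($X\in\{A,B\}$) and their parameterized versions $\langle X\rangle_{<u},\langle X\rangle_{\le u},\langle X\rangle_{>\ell},\langle X\rangle_{\ge \ell},[X]_{<\ell},[X]_{\le \ell},[X]_{>u},[X]_{\ge u}$ (with $u$ ranging over upward and $\ell$ over downward parameters, the two sets being disjoint), in which only intervals $J$ whose length $|J|$ satisfies the indicated comparison with the value of the parameter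 are considered. A valuation $\alpha$ assigns a positive integer to each parameter, and $(w,\alpha)\models\varphi$ means that $\varphi$ holds at $[0,0]$ on $w$ under $\alpha$. For a finite Kripke structure $\mathcal K$ over $AP$ (left-total transition relation, one initial state), $V(\mathcal K,\varphi)$ is the set of valuations $\alpha$ such that $(w,\alpha)\models\varphi$ for every trace $w$ of $\mathcal K$. The size of a formula is its number of distinct subformulas, and $\mathrm{len}_1=\top\wedge[B]\neg\top$ holds exactly at the intervals of length $1$. **Proposition.** There are a finite set $AP$ of atomic propositions, a proposition $\$\in AP$, a finite Kripke structure $\mathcal K$ over $AP$, and $\mathsf{AB}$ formulas $\psi_n$ over $AP$ ($n\ge1$) such that the $\mathsf{P}(\mathsf{AB})$ formulas with a single (upward) parameter $u$ $$\varphi_n=\psi_n\to\langle A\rangle_{\le u}\langle A\rangle(\mathrm{len}_1\wedge \$)$$ (where $\psi\to\chi$ is $\neg\psi\vee\chi$ with $\neg\psi$ put in positive normal form) have size bounded by a polynomial in $n$ and, for a constant $c$ and all $n\ge 1$: $V(\mathcal K,\varphi_n)\neq\emptyset$, and $V(\mathcal K,\varphi_n)$ has a smallest valuation $\alpha_n$,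 with $$2^{2^{n}}\le \alpha_n(u)\le 2^{2^{cn}} .$$ -/

import Mathlib

namespace ParamHS

/-- A trace over `AP`: an infinite word over the alphabet of subsets of `AP`. -/
abbrev Trace (AP : Type) : Type := ℕ → Set AP

/-- Closed non-empty intervals `[i, j]`, `i ≤ j`, of natural numbers (points are allowed). -/
abbrev Ival : Type := NonemptyInterval ℕ

/-- The length `j - i + 1` of the interval `[i, j]`. -/
def Ival.length (I : Ival) : ℕ := I.snd - I.fst + 1

/-- Names of the temporal modalities: the Allen relations, their inverses, and the reflexive
closures of the inverses of "started-by" and "finished-by". -/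
inductive Modality : Type
  | A | L | B | E | D | O
  | Abar | Lbar | Bbar | Ebar | Dbar | Obar
  | BbarW | EbarW

/-- The relation on intervals attached to each modality. -/
def Modality.Rel : Modality → Ival → Ival → Prop
  | .A, I, J => I.snd = J.fst
  | .L, I, J => I.snd < J.fst
  | .B, I, J => I.fst = J.fst ∧ J.snd < I.snd
  | .E, I, J => I.snd = J.snd ∧ I.fst < J.fst
  | .D, I, J => I.fst < J.fst ∧ J.snd < I.snd
  | .O, I, J => I.fst < J.fst ∧ J.fst < I.snd ∧ I.snd < J.snd
  | .Abar, I, J => J.snd = I.fst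
  | .Lbar, I, J => J.snd < I.fst
  | .Bbar, I, J => J.fst = I.fst ∧ I.snd < J.snd
  | .Ebar, I, J => J.snd = I.snd ∧ J.fst < I.fst
  | .Dbar, I, J => J.fst < I.fst ∧ I.snd < J.snd
  | .Obar, I, J => J.fst < I.fst ∧ I.fst < J.snd ∧ J.snd < I.snd
  | .BbarW, I, J => J.fst = I.fst ∧ I.snd ≤ J.snd
  | .EbarW, I, J => J.snd = I.snd ∧ J.fst ≤ I.fst

/-- The proposition `p` holds over the interval `I` of `w` (homogeneity): it holds at every
position of `I`. -/
def HoldsOver {AP : Type} (w : Trace AP) (I : Ival) (p : AP) : Prop :=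
  ∀ h : ℕ, I.fst ≤ h → h ≤ I.snd → p ∈ w h

/-! ### The interval temporal logic HS -/

/-- Formulas of the (parameter-free) interval temporal logic HS. -/
inductive HS (AP : Type) : Type
  | top : HS AP
  | prop : AP → HS AP
  | not : HS AP → HS AP
  | and : HS AP → HS AP → HS AP
  | dia : Modality → HS AP → HS AP

/-- `ψ` only uses temporal modalities from `M`. -/
def HS.InFragment {AP : Type} (M : Set Modality) : HS AP → Prop
  | .top => True
  | .prop _ => True
  | .not φ => φ.InFragment M
  | .and φ ψ => φ.InFragment M ∧ ψ.InFragment M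
  | .dia X φ => X ∈ M ∧ φ.InFragment M

/-- Satisfaction of an HS formula at an interval of a trace. -/
def HS.Sat {AP : Type} (w : Trace AP) : HS AP → Ival → Prop
  | .top, _ => True
  | .prop p, I => HoldsOver w I p
  | .not φ, I => ¬ φ.Sat w I
  | .and φ ψ, I => φ.Sat w I ∧ ψ.Sat w I
  | .dia X φ, I => ∃ J : Ival, X.Rel I J ∧ φ.Sat w J

/-! ### Parametric HS -/

/-- The comparisons `<` and `≤`. -/
inductive UpperCmp : Type
  | lt | le

/-- The comparisons `>` and `≥`. -/
inductive LowerCmp : Type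
  | gt | ge

def UpperCmp.Holds : UpperCmp → ℕ → ℕ → Prop
  | .lt, a, b => a < b
  | .le, a, b => a ≤ b

def LowerCmp.Holds : LowerCmp → ℕ → ℕ → Prop
  | .gt, a, b => a > b
  | .ge, a, b => a ≥ b

/-- Formulas of parametric HS, in positive normal form, over atomic propositions `AP`, upward
parameters `PU` and downward parameters `PL`. The constructor `ntop` is the literal `¬⊤`. -/
inductive PHS (AP PU PL : Type) : Type
  | top : PHS AP PU PL
  | ntop : PHS AP PU PL
  | prop : AP → PHS AP PU PL
  | nprop : AP → PHS AP PU PL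
  | or : PHS AP PU PL → PHS AP PU PL → PHS AP PU PL
  | and : PHS AP PU PL → PHS AP PU PL → PHS AP PU PL
  | dia : Modality → PHS AP PU PL → PHS AP PU PL
  | diaUpper : Modality → UpperCmp → PU → PHS AP PU PL → PHS AP PU PL
  | diaLower : Modality → LowerCmp → PL → PHS AP PU PL → PHS AP PU PL
  | box : Modality → PHS AP PU PL → PHS AP PU PL
  | boxUpper : Modality → UpperCmp → PL → PHS AP PU PL → PHS AP PU PL
  | boxLower : Modality → LowerCmp → PU → PHS AP PU PL → PHS AP PU PL

/-- A parameter valuation assigns a positive integer to every parameter; valuations are ordered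
pointwise. -/
abbrev Valuation (PU PL : Type) : Type := PU ⊕ PL → ℕ+

namespace PHS

variable {AP PU PL : Type}

/-- `φ` only uses temporal modalities (parameterized or not) from `M`. -/
def InFragment (M : Set Modality) : PHS AP PU PL → Prop
  | top => True
  | ntop => True
  | prop _ => True
  | nprop _ => True
  | or φ ψ => φ.InFragment M ∧ ψ.InFragment M
  | and φ ψ => φ.InFragment M ∧ ψ.InFragment M
  | dia X φ => X ∈ M ∧ φ.InFragment M
  | diaUpper X _ _ φ => X ∈ M ∧ φ.InFragment M
  | diaLower X _ _ φ => X ∈ M ∧ φ.InFragment M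
  | box X φ => X ∈ M ∧ φ.InFragment M
  | boxUpper X _ _ φ => X ∈ M ∧ φ.InFragment M
  | boxLower X _ _ φ => X ∈ M ∧ φ.InFragment M

open Classical in
/-- The finite set of subformulas of a formula. -/
noncomputable def subformulas : PHS AP PU PL → Finset (PHS AP PU PL)
  | top => {top}
  | ntop => {ntop}
  | prop p => {prop p}
  | nprop p => {nprop p}
  | or φ ψ => insert (or φ ψ) (φ.subformulas ∪ ψ.subformulas)
  | and φ ψ => insert (and φ ψ) (φ.subformulas ∪ ψ.subformulas)
  | dia X φ => insert (dia X φ) φ.subformulas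
  | diaUpper X r u φ => insert (diaUpper X r u φ) φ.subformulas
  | diaLower X r l φ => insert (diaLower X r l φ) φ.subformulas
  | box X φ => insert (box X φ) φ.subformulas
  | boxUpper X r l φ => insert (boxUpper X r l φ) φ.subformulas
  | boxLower X r u φ => insert (boxLower X r u φ) φ.subformulas

/-- The size of a formula is the number of its distinct subformulas. -/
noncomputable def size (φ : PHS AP PU PL) : ℕ := φ.subformulas.card

/-- Satisfaction of a formula at an interval of the trace `w` under the valuation `α`. -/
def Sat (w : Trace AP) (α : Valuation PU PL) : PHS AP PU PL → Ival → Prop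
  | top, _ => True
  | ntop, _ => False
  | prop p, I => HoldsOver w I p
  | nprop p, I => ¬ HoldsOver w I p
  | or φ ψ, I => φ.Sat w α I ∨ ψ.Sat w α I
  | and φ ψ, I => φ.Sat w α I ∧ ψ.Sat w α I
  | dia X φ, I => ∃ J : Ival, X.Rel I J ∧ φ.Sat w α J
  | diaUpper X r u φ, I =>
      ∃ J : Ival, X.Rel I J ∧ r.Holds J.length (α (Sum.inl u)) ∧ φ.Sat w α J
  | diaLower X r l φ, I =>
      ∃ J : Ival, X.Rel I J ∧ r.Holds J.length (α (Sum.inr l)) ∧ φ.Sat w α J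
  | box X φ, I => ∀ J : Ival, X.Rel I J → φ.Sat w α J
  | boxUpper X r l φ, I =>
      ∀ J : Ival, X.Rel I J → r.Holds J.length (α (Sum.inr l)) → φ.Sat w α J
  | boxLower X r u φ, I =>
      ∀ J : Ival, X.Rel I J → r.Holds J.length (α (Sum.inl u)) → φ.Sat w α J

/-- `(w, α) ⊨ φ`: the formula holds at the initial interval `[0, 0]`. -/
def Models (w : Trace AP) (α : Valuation PU PL) (φ : PHS AP PU PL) : Prop :=
  φ.Sat w α (NonemptyInterval.pure 0)

/-- The formula `len k` (for `k ≥ 1`), which captures the intervals of length `k`: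
`⟨B⟩ ⋯ ⟨B⟩ ⊤` (with `k - 1` modalities) and `[B] ⋯ [B] ¬⊤` (with `k` modalities). -/
def len (k : ℕ) : PHS AP PU PL :=
  and ((dia Modality.B)^[k - 1] top) ((box Modality.B)^[k] ntop)

end PHS

/-- The positive normal form of an HS formula (for `true`) and of its negation (for `false`). -/
def HS.pnf {AP PU PL : Type} : Bool → HS AP → PHS AP PU PL
  | true, .top => .top
  | false, .top => .ntop
  | true, .prop p => .prop p
  | false, .prop p => .nprop p
  | true, .not φ => φ.pnf false
  | false, .not φ => φ.pnf true
  | true, .and φ ψ => .and (φ.pnf true) (ψ.pnf true)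
  | false, .and φ ψ => .or (φ.pnf false) (ψ.pnf false)
  | true, .dia X φ => .dia X (φ.pnf true)
  | false, .dia X φ => .box X (φ.pnf false)

/-- The implication `ψ → χ`, i.e. `¬ψ ∨ χ` with the negation in positive normal form. -/
def HS.imp {AP PU PL : Type} (ψ : HS AP) (χ : PHS AP PU PL) : PHS AP PU PL :=
  .or (ψ.pnf false) χ

theorem HS.sat_pnf {AP PU PL : Type} (w : Trace AP) (α : Valuation PU PL) (ψ : HS AP) :
    ∀ I : Ival, ((ψ.pnf true : PHS AP PU PL).Sat w α I ↔ ψ.Sat w I) ∧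
      ((ψ.pnf false : PHS AP PU PL).Sat w α I ↔ ¬ ψ.Sat w I) := by
  induction ψ with
  | top => intro I; simp [HS.pnf, PHS.Sat, HS.Sat]
  | prop p => intro I; simp [HS.pnf, PHS.Sat, HS.Sat]
  | not φ ih => intro I; simp [HS.pnf, HS.Sat, ih I]
  | and φ ψ ih₁ ih₂ =>
      intro I
      simp only [HS.pnf, PHS.Sat, HS.Sat, ih₁ I, ih₂ I, true_and]
      tauto
  | dia X φ ih =>
      intro I
      simp only [HS.pnf, PHS.Sat, HS.Sat, ih]
      simp

/-- `ψ.imp χ` has the meaning of the implication. -/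
theorem HS.sat_imp {AP PU PL : Type} (w : Trace AP) (α : Valuation PU PL) (ψ : HS AP)
    (χ : PHS AP PU PL) (I : Ival) :
    (ψ.imp χ).Sat w α I ↔ (ψ.Sat w I → χ.Sat w α I) := by
  simp only [HS.imp, PHS.Sat, (ψ.sat_pnf w α I).2]
  tauto

/-! ### Kripke structures -/

/-- Finite Kripke structures over `AP`. -/
structure Kripke (AP : Type) where
  State : Type
  finite_state : Finite State
  E : State → State → Prop
  left_total : ∀ s, ∃ t, E s t
  lab : State → Set AP
  init : State

/-- The set of traces of the infinite paths of `K` that start in the initial state. -/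
def Kripke.traces {AP : Type} (K : Kripke AP) : Set (Trace AP) :=
  {w | ∃ π : ℕ → K.State, π 0 = K.init ∧ (∀ i, K.E (π i) (π (i + 1))) ∧
    ∀ i, w i = K.lab (π i)}

/-- `V(K, φ)`: the valuations under which every trace of `K` satisfies `φ`. -/
def Kripke.V {AP PU PL : Type} (K : Kripke AP) (φ : PHS AP PU PL) : Set (Valuation PU PL) :=
  {α | ∀ w ∈ K.traces, φ.Models w α}

end ParamHS

open ParamHS

/-! The formula `countFormula n` describes a binary counter with `2 ^ n` bits, and the promptness
requirement then measures how long it runs before its top bit becomes one. Positions are grouped in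
cells of length `n`. The `addr` bits of cell `t` spell `t` modulo `2 ^ n`, and the start of the cell
carries one bit of the large counter; `2 ^ n` consecutive cells hold one value.

Both counters obey the same local rules, `IsCounter`, with `M = n` over positions and `M = 2 ^ n`
over cells; explicit carries make the increment local, and the rules determine the bits
(`IsCounter.bit_iff`). Distance `n` is expressed by nested `⟨B⟩`. Distance `2 ^ n` cells would be
too long for this, but an interval joining two cells with equal addresses, none of whose proper
prefixes does so, spans exactly `2 ^ n` cells (`AddrSpec.sat_sameAddr_and_not`).

Hence every model has `$` at position `n * topCell n` (`dollar_of_sat`), while `countTrace n` is a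
model without an earlier one (`sat_countTrace`). So the good values of `u` are exactly those from `n
* topCell n + 1` on (`mem_V_iff`). -/

namespace ParamHS

/-! ### Serial binary counters -/

/-- `x` is the bit stream (least significant bit first, in blocks of `M`) of a counter starting at
zero, and `c` is its carry stream. -/
structure IsCounter (M : ℕ) (x c : ℕ → Prop) : Prop where
  init : ∀ t < M, ¬ x t
  carry_zero : ∀ t, M ∣ t → c t
  carry_succ : ∀ t, ¬ M ∣ t + 1 → (c (t + 1) ↔ c t ∧ x t)
  step : ∀ t, x (t + M) ↔ ¬ (x t ↔ c t)

/-- The bit stream of the counter with blocks of `M` bits. -/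
def counterBit (M t : ℕ) : Prop := (t / M).testBit (t % M) = true

/-- The carry stream of the counter with blocks of `M` bits. -/
def counterCarry (M t : ℕ) : Prop := ∀ b < t % M, (t / M).testBit b = true

/-- An increment flips a bit exactly when the carry reaches it, through ones in all lower places.
The induction halves `m`: an even `m` absorbs the increment in its lowest bit, an odd one passes it
on to `m / 2`. -/
theorem testBit_add_one (m a : ℕ) :
    (m + 1).testBit a = true ↔ ¬ (m.testBit a = true ↔ ∀ b < a, m.testBit b = true) := by
  induction a generalizing m with
  | zero => simp [Nat.testBit_zero]; omega
  | succ a ih =>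
    rw [Nat.testBit_succ, Nat.testBit_succ]
    have key : (∀ b < a + 1, m.testBit b = true) ↔
        m % 2 = 1 ∧ ∀ b < a, (m / 2).testBit b = true := by
      constructor
      · intro h
        refine ⟨by simpa [Nat.testBit_zero] using h 0 (by omega), fun b hb => ?_⟩
        rw [← Nat.testBit_succ]
        exact h _ (by omega)
      · rintro ⟨h0, h⟩ (_ | b) hb
        · simpa [Nat.testBit_zero] using h0
        · rw [Nat.testBit_succ]
          exact h _ (by omega)
    rw [key]
    rcases Nat.mod_two_eq_zero_or_one m with h | h
    · rw [show (m + 1) / 2 = m / 2 by omega]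
      simp [h]
    · rw [show (m + 1) / 2 = m / 2 + 1 by omega, ih]
      simp [h]

theorem succ_div_mod_of_not_dvd {M t : ℕ} (h : ¬ M ∣ t + 1) :
    (t + 1) / M = t / M ∧ (t + 1) % M = t % M + 1 :=
  ⟨Nat.succ_div_of_not_dvd h, by
    have h1 := Nat.div_add_mod t M
    have h2 := Nat.div_add_mod (t + 1) M
    rw [Nat.succ_div_of_not_dvd h] at h2
    omega⟩

theorem isCounter_counterBit {M : ℕ} (hM : 0 < M) :
    IsCounter M (counterBit M) (counterCarry M) where
  init t ht := by simp [counterBit, Nat.div_eq_of_lt ht]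
  carry_zero t ht := by
    intro b hb
    rw [Nat.mod_eq_zero_of_dvd ht] at hb
    omega
  carry_succ t ht := by
    obtain ⟨h1, h2⟩ := succ_div_mod_of_not_dvd ht
    simp only [counterCarry, counterBit, h1, h2, Nat.lt_succ_iff_lt_or_eq]
    constructor
    · exact fun h => ⟨fun b hb => h b (Or.inl hb), h _ (Or.inr rfl)⟩
    · rintro ⟨h, h'⟩ b (hb | rfl)
      exacts [h b hb, h']
  step t := by
    simp only [counterCarry, counterBit, Nat.add_div_right _ hM, Nat.add_mod_right]
    exact testBit_add_one _ _

/-- The rules leave no freedom: a bit is fixed by bit and carry `M` steps earlier, a carry by bit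
and carry one step earlier. Bits and carries therefore go through the induction together. -/
theorem IsCounter.bit_iff {M : ℕ} {x c : ℕ → Prop} (h : IsCounter M x c) (hM : 0 < M) (t : ℕ) :
    x t ↔ counterBit M t := by
  have h' := isCounter_counterBit hM
  suffices H : ∀ t, ((x t ↔ counterBit M t) ∧ (c t ↔ counterCarry M t)) from (H t).1
  intro t
  induction t using Nat.strong_induction_on with
  | _ t ih =>
    constructor
    · rcases lt_or_ge t M with ht | ht
      · exact iff_of_false (h.init t ht) (h'.init t ht)
      · obtain ⟨s, rfl⟩ := Nat.exists_eq_add_of_le' ht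
        rw [h.step, h'.step, (ih s (by omega)).1, (ih s (by omega)).2]
    · by_cases ht : M ∣ t
      · exact iff_of_true (h.carry_zero t ht) (h'.carry_zero t ht)
      · obtain _ | s := t
        · exact absurd (dvd_zero M) ht
        · rw [h.carry_succ s ht, h'.carry_succ s ht, (ih s (by omega)).1, (ih s (by omega)).2]

/-! ### Bits of addresses and congruences modulo powers of two. -/

theorem counterBit_mul_add {M t k : ℕ} (hk : k < M) :
    counterBit M (M * t + k) ↔ t.testBit k = true := by
  have hM : 0 < M := by omega
  rw [counterBit, Nat.mul_add_div hM, Nat.mul_add_mod, Nat.div_eq_of_lt hk, Nat.mod_eq_of_lt hk,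
    add_zero]

theorem mod_two_pow_eq_iff {n a b : ℕ} :
    a % 2 ^ n = b % 2 ^ n ↔ ∀ k < n, (a.testBit k = true ↔ b.testBit k = true) := by
  constructor
  · intro h k hk
    have := congrArg (fun m => m.testBit k) h
    simpa [Nat.testBit_mod_two_pow, hk] using this
  · intro h
    refine Nat.eq_of_testBit_eq fun k => ?_
    rw [Nat.testBit_mod_two_pow, Nat.testBit_mod_two_pow]
    by_cases hk : k < n
    · simp only [hk, decide_true, Bool.true_and]
      exact Bool.eq_iff_iff.2 (h k hk)
    · simp [hk]

theorem two_pow_dvd_iff {n t : ℕ} : 2 ^ n ∣ t ↔ ∀ k < n, ¬ t.testBit k = true := by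
  rw [Nat.dvd_iff_mod_eq_zero, ← Nat.zero_mod (2 ^ n), mod_two_pow_eq_iff]
  simp

theorem mod_two_pow_eq_pred_iff {n t : ℕ} :
    t % 2 ^ n = 2 ^ n - 1 ↔ ∀ k < n, t.testBit k = true := by
  have : 2 ^ n - 1 = (2 ^ n - 1) % 2 ^ n :=
    (Nat.mod_eq_of_lt (Nat.sub_lt (by positivity) one_pos)).symm
  rw [this, mod_two_pow_eq_iff]
  refine forall₂_congr fun k hk => ?_
  simp [Nat.testBit_two_pow_sub_one, hk]

/-! ### Derived connectives of HS -/

namespace HS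

variable {AP : Type}

def impl (φ ψ : HS AP) : HS AP := not (and φ (not ψ))

def iff (φ ψ : HS AP) : HS AP := and (impl φ ψ) (impl ψ φ)

def box (X : Modality) (φ : HS AP) : HS AP := not (dia X (not φ))

/-- The conjunction of the formulas `f k` for `k < n`. -/
def conj (f : ℕ → HS AP) : ℕ → HS AP
  | 0 => top
  | n + 1 => and (conj f n) (f n)

/-- `⟨B⟩ ⋯ ⟨B⟩ ⊤` with `k` modalities: the interval has length greater than `k`. -/
def longer : ℕ → HS AP
  | 0 => top
  | k + 1 => dia .B (longer k)

/-- The interval has length `k + 1`. -/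
def exactly (k : ℕ) : HS AP := and (longer k) (not (longer (k + 1)))

/-- `p` holds `k` positions after the right end of the interval. -/
def rightAt (k : ℕ) (p : AP) : HS AP :=
  dia .A (and (exactly k) (dia .A (and (exactly 0) (prop p))))

/-- `p` holds `k` positions after the left end of the interval, and before its right end. -/
def leftAt (k : ℕ) (p : AP) : HS AP :=
  dia .B (and (exactly k) (dia .A (and (exactly 0) (prop p))))

section Sat

variable {w : Trace AP} {I : Ival}

@[simp] theorem sat_top : (top : HS AP).Sat w I ↔ True := Iff.rfl

@[simp] theorem sat_not {φ : HS AP} : (not φ).Sat w I ↔ ¬ φ.Sat w I := Iff.rfl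

@[simp] theorem sat_and {φ ψ : HS AP} : (and φ ψ).Sat w I ↔ φ.Sat w I ∧ ψ.Sat w I := Iff.rfl

@[simp] theorem sat_impl {φ ψ : HS AP} : (impl φ ψ).Sat w I ↔ (φ.Sat w I → ψ.Sat w I) := by
  simp [impl]

@[simp] theorem sat_iff {φ ψ : HS AP} : (iff φ ψ).Sat w I ↔ (φ.Sat w I ↔ ψ.Sat w I) := by
  simp [iff, iff_def]

@[simp] theorem sat_conj {f : ℕ → HS AP} {n : ℕ} :
    (conj f n).Sat w I ↔ ∀ k < n, (f k).Sat w I := by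
  induction n with
  | zero => simp [conj]
  | succ n ih =>
    simp only [conj, sat_and, ih, Nat.lt_succ_iff_lt_or_eq]
    constructor
    · rintro ⟨h, h'⟩ b (hb | rfl)
      exacts [h b hb, h']
    · exact fun h => ⟨fun b hb => h b (Or.inl hb), h _ (Or.inr rfl)⟩

theorem sat_dia_A {φ : HS AP} :
    (dia .A φ).Sat w I ↔ ∃ k, ∃ h : I.snd ≤ k, φ.Sat w ⟨(I.snd, k), h⟩ := by
  constructor
  · rintro ⟨⟨⟨a, b⟩, h⟩, hA, hs⟩
    obtain rfl : I.snd = a := hA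
    exact ⟨b, h, hs⟩
  · rintro ⟨k, h, hs⟩
    exact ⟨⟨(I.snd, k), h⟩, rfl, hs⟩

theorem sat_dia_B {φ : HS AP} :
    (dia .B φ).Sat w I ↔ ∃ k, ∃ h : I.fst ≤ k, k < I.snd ∧ φ.Sat w ⟨(I.fst, k), h⟩ := by
  constructor
  · rintro ⟨⟨⟨a, b⟩, h⟩, ⟨hA, hB⟩, hs⟩
    obtain rfl : I.fst = a := hA
    exact ⟨b, h, hB, hs⟩
  · rintro ⟨k, h, h', hs⟩
    exact ⟨⟨(I.fst, k), h⟩, ⟨rfl, h'⟩, hs⟩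

theorem sat_box_A {φ : HS AP} :
    (box .A φ).Sat w I ↔ ∀ k, ∀ h : I.snd ≤ k, φ.Sat w ⟨(I.snd, k), h⟩ := by
  simp [box, sat_dia_A]

@[simp] theorem sat_longer {k : ℕ} : (longer k : HS AP).Sat w I ↔ I.fst + k ≤ I.snd := by
  induction k generalizing I with
  | zero => simpa [longer] using I.fst_le_snd
  | succ k ih =>
    simp only [longer, sat_dia_B, ih]
    constructor
    · rintro ⟨j, -, h, h'⟩
      omega
    · intro h
      exact ⟨I.fst + k, by omega, by omega, le_rfl⟩

@[simp] theorem sat_exactly {k : ℕ} : (exactly k : HS AP).Sat w I ↔ I.snd = I.fst + k := by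
  simp only [exactly, sat_and, sat_not, sat_longer]
  omega

theorem sat_point {p : AP} :
    (dia .A (and (exactly 0) (prop p))).Sat w I ↔ p ∈ w I.snd := by
  simp only [sat_dia_A, sat_and, sat_exactly]
  constructor
  · rintro ⟨k, h, -, hs⟩
    exact hs _ le_rfl h
  · intro h
    refine ⟨I.snd, le_rfl, by simp, fun j h₁ h₂ => ?_⟩
    obtain rfl : I.snd = j := le_antisymm h₁ h₂
    exact h

@[simp] theorem sat_rightAt {k : ℕ} {p : AP} :
    (rightAt k p).Sat w I ↔ p ∈ w (I.snd + k) := by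
  rw [rightAt, sat_dia_A]
  simp only [sat_and, sat_exactly, sat_point]
  constructor
  · rintro ⟨j, -, rfl, hp⟩
    exact hp
  · exact fun h => ⟨_, by omega, rfl, h⟩

@[simp] theorem sat_leftAt {k : ℕ} {p : AP} :
    (leftAt k p).Sat w I ↔ I.fst + k < I.snd ∧ p ∈ w (I.fst + k) := by
  rw [leftAt, sat_dia_B]
  simp only [sat_and, sat_exactly, sat_point]
  constructor
  · rintro ⟨j, -, h, rfl, hp⟩
    exact ⟨h, hp⟩
  · exact fun h => ⟨_, by omega, h.1, rfl, h.2⟩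

end Sat

/-! ### Fragments and sizes -/

section Fragment

variable {M : Set Modality}

theorem inFragment_conj {f : ℕ → HS AP} {n : ℕ} (h : ∀ k, (f k).InFragment M) :
    (conj f n).InFragment M := by
  induction n with
  | zero => trivial
  | succ n ih => exact ⟨ih, h n⟩

theorem inFragment_longer (hB : Modality.B ∈ M) (k : ℕ) : (longer k : HS AP).InFragment M := by
  induction k with
  | zero => trivial
  | succ k ih => exact ⟨hB, ih⟩

theorem inFragment_exactly (hB : Modality.B ∈ M) (k : ℕ) : (exactly k : HS AP).InFragment M :=
  ⟨inFragment_longer hB k, inFragment_longer hB (k + 1)⟩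

theorem inFragment_rightAt (hA : Modality.A ∈ M) (hB : Modality.B ∈ M) (k : ℕ) (p : AP) :
    (rightAt k p).InFragment M :=
  ⟨hA, inFragment_exactly hB k, hA, inFragment_exactly hB 0, trivial⟩

theorem inFragment_leftAt (hA : Modality.A ∈ M) (hB : Modality.B ∈ M) (k : ℕ) (p : AP) :
    (leftAt k p).InFragment M :=
  ⟨hB, inFragment_exactly hB k, hA, inFragment_exactly hB 0, trivial⟩

theorem inFragment_pnf {PU PL : Type} {φ : HS AP} (h : φ.InFragment M) (b : Bool) :
    (φ.pnf b : PHS AP PU PL).InFragment M := by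
  induction φ generalizing b with
  | top => cases b <;> trivial
  | prop p => cases b <;> trivial
  | not φ ih => cases b <;> exact ih h _
  | and φ ψ ih₁ ih₂ => cases b <;> exact ⟨ih₁ h.1 _, ih₂ h.2 _⟩
  | dia X φ ih => cases b <;> exact ⟨h.1, ih h.2 _⟩

end Fragment

/-- The number of nodes of the syntax tree. -/
def nodes : HS AP → ℕ
  | top => 1
  | prop _ => 1
  | not φ => φ.nodes + 1
  | and φ ψ => φ.nodes + ψ.nodes + 1
  | dia _ φ => φ.nodes + 1

/-- Negations vanish in positive normal form and every other node yields one node, so the tree size,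
which is easy to add up, bounds the number of distinct subformulas. -/
theorem size_pnf_le {PU PL : Type} (φ : HS AP) (b : Bool) :
    (φ.pnf b : PHS AP PU PL).size ≤ φ.nodes := by
  classical
  unfold PHS.size
  induction φ generalizing b with
  | top => cases b <;> simp [pnf, PHS.subformulas, nodes]
  | prop p => cases b <;> simp [pnf, PHS.subformulas, nodes]
  | not φ ih => cases b <;> exact (ih _).trans (Nat.le_succ _)
  | and φ ψ ih₁ ih₂ =>
    cases b <;>
    · refine (Finset.card_insert_le _ _).trans (Nat.succ_le_succ ?_)
      exact (Finset.card_union_le _ _).trans (add_le_add (ih₁ _) (ih₂ _))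
  | dia X φ ih =>
    cases b <;> exact (Finset.card_insert_le _ _).trans (Nat.succ_le_succ (ih _))

theorem size_imp_le {PU PL : Type} (φ : HS AP) (χ : PHS AP PU PL) :
    (φ.imp χ).size ≤ φ.nodes + χ.size + 1 := by
  classical
  refine (Finset.card_insert_le _ _).trans (Nat.succ_le_succ ?_)
  exact (Finset.card_union_le _ _).trans (add_le_add (size_pnf_le _ _) le_rfl)

@[simp] theorem nodes_longer (k : ℕ) : (longer k : HS AP).nodes = k + 1 := by
  induction k with
  | zero => rfl
  | succ k ih => simp [longer, nodes, ih]

@[simp] theorem nodes_rightAt (k : ℕ) (p : AP) : (rightAt k p).nodes = 2 * k + 15 := by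
  simp [rightAt, exactly, nodes]
  ring

@[simp] theorem nodes_leftAt (k : ℕ) (p : AP) : (leftAt k p).nodes = 2 * k + 15 := by
  simp [leftAt, exactly, nodes]
  ring

theorem nodes_conj_le {f : ℕ → HS AP} {n m : ℕ} (h : ∀ k < n, (f k).nodes ≤ m) :
    (conj f n).nodes ≤ n * (m + 1) + 1 := by
  induction n with
  | zero => simp [conj, nodes]
  | succ n ih =>
    have h1 := ih fun k hk => h k (by omega)
    have h2 := h n (by omega)
    simp only [conj, nodes]
    linarith

end HS

/-! ### The counting formula -/

/-- The propositions of the counting traces: `cell` marks the first position of a cell, `addr` and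
`addrCarry` are the bits of the cell addresses and their carries, `bit` and `carry` those of the
counter spread over the cells. -/
inductive Letter : Type
  | cell | addr | addrCarry | bit | carry | dollar

open HS Letter

/-- The address that begins `m` positions after the right end is zero. -/
def addrZero (n m : ℕ) : HS Letter := conj (fun k => not (rightAt (m + k) addr)) n

/-- The address at the right end consists of ones. -/
def addrOnes (n : ℕ) : HS Letter := conj (fun k => rightAt k addr) n

/-- The interval joins the starts of two distinct cells with the same address. -/
def sameAddr (n : ℕ) : HS Letter :=
  and (and (leftAt 0 cell) (rightAt 0 cell))
    (conj (fun k => iff (leftAt k addr) (rightAt k addr)) n)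

/-- The properties of the cell markers and of the addresses around a position. -/
def addrRules (n : ℕ) : HS Letter :=
  and (and (iff (rightAt n cell) (rightAt 0 cell))
      (impl (rightAt 0 cell) (conj (fun k => not (rightAt (k + 1) cell)) (n - 1))))
    (and (and (impl (rightAt 0 cell) (rightAt 0 addrCarry))
        (impl (not (rightAt 1 cell))
          (iff (rightAt 1 addrCarry) (and (rightAt 0 addrCarry) (rightAt 0 addr)))))
      (iff (rightAt n addr) (not (iff (rightAt 0 addr) (rightAt 0 addrCarry)))))

/-- The properties of the carries and of the end marker around the start of a cell. -/
def cellRules (n : ℕ) : HS Letter :=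
  impl (rightAt 0 cell)
    (and (and (impl (addrZero n 0) (rightAt 0 carry))
        (impl (not (addrZero n n))
          (iff (rightAt n carry) (and (rightAt 0 carry) (rightAt 0 bit)))))
      (impl (and (rightAt 0 bit) (addrOnes n)) (rightAt 0 dollar)))

/-- No bit at the right end if all cells of the interval have distinct addresses. -/
def initRule (n : ℕ) : HS Letter :=
  impl (and (not (sameAddr n)) (not (dia .B (sameAddr n)))) (not (rightAt 0 bit))

/-- The counter is incremented between consecutive cells with the same address. -/
def stepRule (n : ℕ) : HS Letter :=
  impl (and (sameAddr n) (not (dia .B (sameAddr n))))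
    (iff (rightAt 0 bit) (not (iff (leftAt 0 bit) (leftAt 0 carry))))

/-- The trace counts with `2 ^ n` bits, and has a `$` when the top bit becomes one. -/
def countFormula (n : ℕ) : HS Letter :=
  and (and (rightAt 0 cell) (addrZero n 0))
    (box .A (and (and (addrRules n) (cellRules n)) (and (initRule n) (box .A (stepRule n)))))

theorem inFragment_countFormula (n : ℕ) :
    (countFormula n).InFragment {Modality.A, Modality.B} := by
  have hA : Modality.A ∈ ({Modality.A, Modality.B} : Set Modality) := by simp
  have hB : Modality.B ∈ ({Modality.A, Modality.B} : Set Modality) := by simp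
  have hr := fun k (p : Letter) => inFragment_rightAt hA hB k p
  have hl := fun k (p : Letter) => inFragment_leftAt hA hB k p
  have hn := fun m k (p : Letter) =>
    inFragment_conj (f := fun k => not (rightAt (m + k) p)) (n := k) fun _ => hr _ p
  have hn' := fun k (p : Letter) =>
    inFragment_conj (f := fun k => not (rightAt (k + 1) p)) (n := k) fun _ => hr _ p
  have hs : (sameAddr n).InFragment {Modality.A, Modality.B} :=
    ⟨⟨hl _ _, hr _ _⟩, inFragment_conj fun k => ⟨⟨hl _ _, hr _ _⟩, hr _ _, hl _ _⟩⟩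
  simp only [countFormula, addrRules, cellRules, initRule, stepRule, addrZero, addrOnes,
    box, impl, iff, InFragment, hr, hl, hn, hn', hs, hA, hB, inFragment_conj, and_self,
    implies_true]

/-- The formula contains boundedly many conjunctions of at most `n` formulas of linear size; the
constant is generous. -/
theorem nodes_countFormula_le (n : ℕ) : (countFormula n).nodes ≤ 1000 * (n + 1) ^ 2 := by
  have h1 : ∀ m ≤ n, (addrZero n m).nodes ≤ n * (4 * n + 17) + 1 := fun m hm =>
    nodes_conj_le fun k hk => by simp [nodes]; omega
  have h2 : (addrOnes n).nodes ≤ n * (2 * n + 16) + 1 :=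
    nodes_conj_le fun k hk => by simp; omega
  have h3 : (sameAddr n).nodes ≤ n * (8 * n + 70) + 40 := by
    have : (conj (fun k => iff (leftAt k addr) (rightAt k addr)) n).nodes ≤
        n * (8 * n + 69 + 1) + 1 :=
      nodes_conj_le fun k hk => by simp [nodes, iff, impl]; omega
    simp [sameAddr, nodes]
    linarith
  have h4 : (conj (fun k => not (rightAt (k + 1) cell)) (n - 1)).nodes ≤
      n * (2 * n + 17) + 1 :=
    (nodes_conj_le (m := 2 * n + 16) fun k hk => by simp [nodes]; omega).trans
      (by gcongr; omega)
  have h5 := h1 0 (Nat.zero_le n)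
  have h6 := h1 n le_rfl
  simp [countFormula, addrRules, cellRules, initRule, stepRule, box, impl, iff, nodes]
  nlinarith

/-! ### Meaning of the counting formula -/

/-- The cell markers and the addresses of `w` are the intended ones. -/
structure AddrSpec (n : ℕ) (w : Trace Letter) : Prop where
  cell_iff : ∀ s, cell ∈ w s ↔ n ∣ s
  addr_iff : ∀ s, addr ∈ w s ↔ counterBit n s

theorem addrSpec_of_sat {n : ℕ} (hn : 0 < n) {w : Trace Letter}
    (h : (countFormula n).Sat w (NonemptyInterval.pure 0)) : AddrSpec n w := by
  simp [countFormula, sat_box_A, addrRules, addrZero] at h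
  obtain ⟨⟨h0, hz⟩, h⟩ := h
  have hcell : ∀ s, cell ∈ w s ↔ n ∣ s := by
    -- The marker at position `0` excludes markers at the next `n - 1` positions; periodicity does
    -- the rest.
    have hr : ∀ r < n, (cell ∈ w r ↔ n ∣ r) := by
      rintro (_ | r) hr
      · simpa using h0
      · refine iff_of_false ?_ (Nat.not_dvd_of_pos_of_lt (by omega) hr)
        have := (h 0).1.1.1.2 h0 r (by omega)
        simpa using this
    intro s
    induction s using Nat.strong_induction_on with
    | _ s ih =>
      rcases lt_or_ge s n with hs | hs
      · exact hr s hs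
      · obtain ⟨s, rfl⟩ := Nat.exists_eq_add_of_le' hs
        rw [(h s).1.1.1.1, ih s (by omega), Nat.dvd_add_self_right]
  refine ⟨hcell, fun s => IsCounter.bit_iff (c := fun s => addrCarry ∈ w s)
    (x := fun s => addr ∈ w s) ?_ hn s⟩
  refine ⟨hz, fun t ht => ?_, fun t ht => ?_, fun t => ?_⟩
  · exact (h t).1.1.2.1.1 ((hcell t).2 ht)
  · exact (h t).1.1.2.1.2 (by rwa [hcell])
  · rw [(h t).1.1.2.2]

section Addresses

variable {n : ℕ} {w : Trace Letter} (hw : AddrSpec n w)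
include hw

theorem AddrSpec.addr_mul_add {k : ℕ} (hk : k < n) (t : ℕ) :
    addr ∈ w (n * t + k) ↔ t.testBit k = true := by
  rw [hw.addr_iff, counterBit_mul_add hk]

theorem AddrSpec.sat_addrZero {I : Ival} {m t : ℕ} (hI : I.snd + m = n * t) :
    (addrZero n m).Sat w I ↔ 2 ^ n ∣ t := by
  rw [two_pow_dvd_iff, addrZero, sat_conj]
  refine forall₂_congr fun k hk => ?_
  rw [sat_not, sat_rightAt, ← add_assoc, hI, hw.addr_mul_add hk]

theorem AddrSpec.sat_addrOnes {I : Ival} {t : ℕ} (hI : I.snd = n * t) :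
    (addrOnes n).Sat w I ↔ t % 2 ^ n = 2 ^ n - 1 := by
  rw [mod_two_pow_eq_pred_iff, addrOnes, sat_conj]
  refine forall₂_congr fun k hk => ?_
  rw [sat_rightAt, hI, hw.addr_mul_add hk]

theorem AddrSpec.sat_sameAddr (hn : 0 < n) {I : Ival} : (sameAddr n).Sat w I ↔
    ∃ t t', t < t' ∧ I.fst = n * t ∧ I.snd = n * t' ∧ t % 2 ^ n = t' % 2 ^ n := by
  have key : ∀ t t', t < t' → I.fst = n * t → I.snd = n * t' →
      ((conj (fun k => iff (leftAt k addr) (rightAt k addr)) n).Sat w I ↔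
        t % 2 ^ n = t' % 2 ^ n) := by
    intro t t' htt h1 h2
    rw [mod_two_pow_eq_iff, sat_conj]
    refine forall₂_congr fun k hk => ?_
    rw [sat_iff, sat_leftAt, sat_rightAt, h1, h2, hw.addr_mul_add hk, hw.addr_mul_add hk,
      and_iff_right]
    -- Cell `t` ends before cell `t'` starts, so `leftAt` reads all of its address bits inside the
    -- interval.
    have : n * (t + 1) ≤ n * t' := Nat.mul_le_mul_left n htt
    linarith
  rw [sameAddr, sat_and, sat_and, sat_leftAt, sat_rightAt, add_zero, add_zero, hw.cell_iff,
    hw.cell_iff]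
  constructor
  -- `h` is the strictness of the prefix in `leftAt 0`; it rules out point intervals.
  · rintro ⟨⟨⟨h, t, h1⟩, t', h2⟩, h3⟩
    have htt : t < t' := by
      rw [h1, h2] at h
      exact lt_of_mul_lt_mul_left h (Nat.zero_le n)
    exact ⟨t, t', htt, h1, h2, (key t t' htt h1 h2).1 h3⟩
  · rintro ⟨t, t', htt, h1, h2, h3⟩
    refine ⟨⟨⟨?_, t, h1⟩, t', h2⟩, (key t t' htt h1 h2).2 h3⟩
    rw [h1, h2]
    exact Nat.mul_lt_mul_of_pos_left htt hn

/-- The address of cell `t` first recurs in cell `t + 2 ^ n`, so this is the shortest candidate for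
the prefix. -/
theorem AddrSpec.sat_dia_B_sameAddr (hn : 0 < n) {I : Ival} : (dia .B (sameAddr n)).Sat w I ↔
    ∃ t, I.fst = n * t ∧ n * (t + 2 ^ n) < I.snd := by
  rw [sat_dia_B]
  simp only [hw.sat_sameAddr hn]
  constructor
  · rintro ⟨k, h, hk, t, t', htt, h1, h2, h3⟩
    refine ⟨t, h1, lt_of_le_of_lt ?_ hk⟩
    change k = _ at h2
    rw [h2]
    refine Nat.mul_le_mul_left n ?_
    obtain ⟨q, hq⟩ := (Nat.modEq_iff_dvd' htt.le).1 h3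
    have : q ≠ 0 := by
      rintro rfl
      omega
    have : 2 ^ n * 1 ≤ 2 ^ n * q := Nat.mul_le_mul_left _ (by omega)
    omega
  · rintro ⟨t, h1, h2⟩
    exact ⟨n * (t + 2 ^ n), by rw [h1]; exact Nat.mul_le_mul_left n (Nat.le_add_right _ _), h2,
      t, t + 2 ^ n,
      Nat.lt_add_of_pos_right (by positivity), h1, rfl, (Nat.add_mod_right _ _).symm⟩

/-- This is how a formula of polynomial size measures an exponential distance: equality of addresses
gives a multiple of `2 ^ n` cells, and minimality among prefixes selects the first. -/
theorem AddrSpec.sat_sameAddr_and_not (hn : 0 < n) {I : Ival} :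
    ((sameAddr n).Sat w I ∧ ¬ (dia .B (sameAddr n)).Sat w I) ↔
      ∃ t, I.fst = n * t ∧ I.snd = n * (t + 2 ^ n) := by
  rw [hw.sat_sameAddr hn, hw.sat_dia_B_sameAddr hn]
  constructor
  · rintro ⟨⟨t, t', htt, h1, h2, h3⟩, h4⟩
    refine ⟨t, h1, ?_⟩
    obtain ⟨q, hq⟩ := (Nat.modEq_iff_dvd' htt.le).1 h3
    have hle : I.snd ≤ n * (t + 2 ^ n) := not_lt.1 fun h => h4 ⟨t, h1, h⟩
    rw [h2] at hle ⊢
    have : t' ≤ t + 2 ^ n := le_of_mul_le_mul_left hle hn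
    have : q ≠ 0 := by
      rintro rfl
      omega
    have : 2 ^ n * 1 ≤ 2 ^ n * q := Nat.mul_le_mul_left _ (by omega)
    congr 1
    omega
  · rintro ⟨t, h1, h2⟩
    refine ⟨⟨t, _, Nat.lt_add_of_pos_right (by positivity), h1, h2,
      (Nat.add_mod_right _ _).symm⟩, ?_⟩
    rintro ⟨t', h1', h2'⟩
    rw [h1] at h1'
    obtain rfl : t = t' := Nat.eq_of_mul_eq_mul_left hn h1'
    omega

end Addresses

/-- The first cell in which the top bit of the counter with `2 ^ n` bits is one. -/
def topCell (n : ℕ) : ℕ := 2 ^ n * 2 ^ (2 ^ n - 1) + (2 ^ n - 1)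

/-- The bits at cell starts form a counter with `M = 2 ^ n`, indexed by cells. In `topCell n` the
value is `2 ^ (2 ^ n - 1)` and the address is the last one, which triggers the `$` clause. -/
theorem dollar_of_sat {n : ℕ} (hn : 0 < n) {w : Trace Letter}
    (h : (countFormula n).Sat w (NonemptyInterval.pure 0)) : dollar ∈ w (n * topCell n) := by
  have hw := addrSpec_of_sat hn h
  have hN : 0 < 2 ^ n := by positivity
  simp only [countFormula, sat_and, sat_box_A] at h
  obtain ⟨-, h⟩ := h
  have hcell : ∀ t, cell ∈ w (n * t) := fun t => (hw.cell_iff _).2 (dvd_mul_right n t)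
  have hbit : ∀ t, bit ∈ w (n * t) ↔ counterBit (2 ^ n) t := by
    refine fun t => IsCounter.bit_iff (x := fun t => bit ∈ w (n * t))
      (c := fun t => carry ∈ w (n * t)) ⟨fun t ht => ?_, fun t ht => ?_, fun t ht => ?_,
        fun t => ?_⟩ hN t
    · have := (h (n * t) (Nat.zero_le _)).2.1
      simp only [initRule, sat_impl, sat_and, sat_not, sat_rightAt] at this
      -- Among the first `2 ^ n` cells no address recurs, so the premise of `initRule` holds.
      refine this ⟨?_, ?_⟩
      · rw [hw.sat_sameAddr hn]
        rintro ⟨a, b, hab, h1, h2, h3⟩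
        have hb : t = b := Nat.eq_of_mul_eq_mul_left hn h2
        have ha : a = 0 := by
          have : 0 = n * a := h1
          rcases mul_eq_zero.1 this.symm with h | h <;> omega
        subst hb ha
        rw [Nat.zero_mod, Nat.mod_eq_of_lt ht] at h3
        omega
      · rw [hw.sat_dia_B_sameAddr hn]
        rintro ⟨a, h1, h2⟩
        have : a + 2 ^ n < t := lt_of_mul_lt_mul_left h2 (Nat.zero_le n)
        omega
    · have := (h (n * t) (Nat.zero_le _)).1.2
      simp only [cellRules, sat_impl, sat_and, sat_rightAt] at this
      exact (this (hcell t)).1.1 ((hw.sat_addrZero rfl).2 ht)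
    · have := (h (n * t) (Nat.zero_le _)).1.2
      simp only [cellRules, sat_impl, sat_and, sat_rightAt, sat_not, sat_iff] at this
      -- The address `n` positions ahead is that of cell `t + 1`.
      exact (this (hcell t)).1.2 (by rwa [hw.sat_addrZero (t := t + 1) rfl])
    · have := (h (n * t) (Nat.zero_le _)).2.2 (n * (t + 2 ^ n))
        (Nat.mul_le_mul_left n (Nat.le_add_right _ _))
      simp only [stepRule, sat_impl, sat_and, sat_rightAt, sat_leftAt, sat_not, sat_iff] at this
      have h2 : n * t < n * (t + 2 ^ n) :=
        Nat.mul_lt_mul_of_pos_left (Nat.lt_add_of_pos_right hN) hn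
      simpa [h2] using this ((hw.sat_sameAddr_and_not hn).2 ⟨t, rfl, rfl⟩)
  have := (h (n * topCell n) (Nat.zero_le _)).1.2
  simp only [cellRules, sat_impl, sat_and, sat_rightAt] at this
  have hlt : 2 ^ n - 1 < 2 ^ n := by omega
  refine (this (hcell _)).2 ⟨?_, ?_⟩
  · refine (hbit _).2 ?_
    rw [topCell, counterBit_mul_add hlt]
    exact Nat.testBit_two_pow_self
  · rw [hw.sat_addrOnes rfl, topCell, Nat.mul_add_mod, Nat.mod_eq_of_lt hlt]

/-! ### The longest counting trace -/

/-- The intended trace, with `$` from the first top bit on. -/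
def countTrace (n : ℕ) : Trace Letter := fun s => {p | match p with
  | cell => n ∣ s
  | addr => counterBit n s
  | addrCarry => counterCarry n s
  | bit => n ∣ s ∧ counterBit (2 ^ n) (s / n)
  | carry => counterCarry (2 ^ n) (s / n)
  | dollar => n * topCell n ≤ s}

theorem addrSpec_countTrace (n : ℕ) : AddrSpec n (countTrace n) :=
  ⟨fun _ => Iff.rfl, fun _ => Iff.rfl⟩

theorem sat_countTrace {n : ℕ} (hn : 0 < n) :
    (countFormula n).Sat (countTrace n) (NonemptyInterval.pure 0) := by
  have hw := addrSpec_countTrace n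
  have hN : 0 < 2 ^ n := by positivity
  have hc := isCounter_counterBit hn
  have hC := isCounter_counterBit hN
  have hcell : ∀ s, cell ∈ countTrace n s ↔ n ∣ s := fun _ => Iff.rfl
  have haddr : ∀ s, addr ∈ countTrace n s ↔ counterBit n s := fun _ => Iff.rfl
  have haddrC : ∀ s, addrCarry ∈ countTrace n s ↔ counterCarry n s := fun _ => Iff.rfl
  have hbit : ∀ t, bit ∈ countTrace n (n * t) ↔ counterBit (2 ^ n) t := fun t => by
    change (n ∣ n * t ∧ counterBit (2 ^ n) (n * t / n)) ↔ _
    rw [Nat.mul_div_cancel_left t hn]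
    simp
  have hcarry : ∀ t, carry ∈ countTrace n (n * t) ↔ counterCarry (2 ^ n) t := fun t => by
    change counterCarry (2 ^ n) (n * t / n) ↔ _
    rw [Nat.mul_div_cancel_left t hn]
  simp only [countFormula, sat_and, sat_box_A]
  refine ⟨⟨?_, ?_⟩, fun s _ => ⟨⟨?_, ?_⟩, ?_, fun s' hs' => ?_⟩⟩
  · simp [hcell]
  · rw [hw.sat_addrZero (t := 0) rfl]
    simp
  · simp only [addrRules, sat_impl, sat_and, sat_rightAt, sat_not, sat_iff, sat_conj, hcell, haddr,
      haddrC]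
    refine ⟨⟨Nat.dvd_add_self_right, fun h k hk h' => ?_⟩,
      ⟨hc.carry_zero s, hc.carry_succ s⟩, hc.step s⟩
    exact Nat.not_dvd_of_pos_of_lt (Nat.succ_pos k) (by omega) ((Nat.dvd_add_right h).1 h')
  · simp only [cellRules, sat_impl, sat_and, sat_rightAt, sat_not, sat_iff]
    rintro ⟨t, rfl : s = n * t⟩
    rw [hw.sat_addrZero (t := t) rfl, hw.sat_addrZero (t := t + 1) rfl,
      hw.sat_addrOnes (t := t) rfl]
    refine ⟨⟨fun h => (hcarry t).2 (hC.carry_zero t h), fun h => ?_⟩, ?_⟩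
    · have := hC.carry_succ t h
      rw [← hcarry, ← hcarry, ← hbit] at this
      exact this
    · rintro ⟨h1, h2⟩
      have h1 := (hbit t).1 h1
      change n * topCell n ≤ n * t
      refine Nat.mul_le_mul_left n ?_
      -- A number whose bit `2 ^ n - 1` is one is at least `2 ^ (2 ^ n - 1)`; with the last address,
      -- the cell is not before `topCell n`.
      rw [counterBit, h2] at h1
      have h3 := Nat.mul_le_mul_left (2 ^ n) (Nat.ge_two_pow_of_testBit h1)
      have h4 := Nat.div_add_mod t (2 ^ n)
      rw [topCell]
      omega
  · simp only [initRule, sat_impl, sat_and, sat_rightAt, sat_not]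
    -- `initRule` also concerns positions inside cells; there `bit` fails because `countTrace`
    -- places it at multiples of `n` only.
    rintro ⟨h1, h2⟩ ⟨⟨t, rfl : s = n * t⟩, h3⟩
    have h3 := (hbit t).1 ⟨dvd_mul_right n t, h3⟩
    rcases lt_or_ge t (2 ^ n) with ht | ht
    · exact hC.init t ht h3
    -- From cell `2 ^ n` on the premise fails: address zero recurs at the right end itself or at the
    -- end of a proper prefix.
    · rcases ht.eq_or_lt with rfl | ht
      · exact h1 ((hw.sat_sameAddr hn).2 ⟨0, 2 ^ n, hN, rfl, rfl, by simp⟩)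
      · refine h2 ((hw.sat_dia_B_sameAddr hn).2 ⟨0, rfl, ?_⟩)
        rw [zero_add]
        exact Nat.mul_lt_mul_of_pos_left ht hn
  · simp only [stepRule, sat_impl, sat_and, sat_rightAt, sat_leftAt, sat_not, sat_iff]
    intro h
    obtain ⟨t, rfl : s = n * t, rfl : s' = n * (t + 2 ^ n)⟩ := (hw.sat_sameAddr_and_not hn).1 h
    have h2 : n * t < n * (t + 2 ^ n) :=
      Nat.mul_lt_mul_of_pos_left (Nat.lt_add_of_pos_right hN) hn
    have := hC.step t
    rw [← hcarry, ← hbit, ← hbit] at this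
    simpa [h2] using this

/-! ### The Kripke structure -/

instance : Finite Letter := by
  refine Finite.of_surjective (![cell, addr, addrCarry, bit, carry, dollar] : Fin 6 → Letter) ?_
  rintro (_ | _)
  exacts [⟨0, rfl⟩, ⟨1, rfl⟩, ⟨2, rfl⟩, ⟨3, rfl⟩, ⟨4, rfl⟩, ⟨5, rfl⟩]

/-- The Kripke structure of all traces with a given first letter. -/
def universalKripke {AP : Type} [Finite AP] (a : Set AP) : Kripke AP where
  State := Set AP
  finite_state := inferInstance
  E _ _ := True
  left_total s := ⟨s, trivial⟩
  lab s := s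
  init := a

theorem mem_traces_universalKripke {AP : Type} [Finite AP] {a : Set AP} {w : Trace AP}
    (h : w 0 = a) :
    w ∈ (universalKripke a).traces :=
  ⟨w, h, fun _ => trivial, fun _ => rfl⟩

theorem topCell_pos {n : ℕ} : 0 < topCell n := by
  unfold topCell
  positivity

/-- The first letter does not depend on `n`, so one structure with a single initial state serves all
`n`. -/
theorem countTrace_zero {n : ℕ} (hn : 0 < n) :
    countTrace n 0 = {cell, addrCarry, carry} := by
  ext p
  cases p
  · simp [countTrace]
  · simp [countTrace, counterBit]
  · simp [countTrace, counterCarry]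
  · simp [countTrace, counterBit]
  · simp [countTrace, counterCarry]
  · simpa [countTrace] using ⟨hn.ne', topCell_pos.ne'⟩

/-- `⟨A⟩_{≤ u} ⟨A⟩ (len 1 ∧ p)`. -/
def promptly {AP : Type} (p : AP) : PHS AP Unit Empty :=
  PHS.diaUpper Modality.A UpperCmp.le ()
    (PHS.dia Modality.A (PHS.and (PHS.len 1) (PHS.prop p)))

theorem models_promptly {AP : Type} {p : AP} {w : Trace AP} {α : Valuation Unit Empty} :
    (promptly p).Models w α ↔ ∃ s, s + 1 ≤ (α (Sum.inl ()) : ℕ) ∧ p ∈ w s := by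
  constructor
  · rintro ⟨⟨⟨a, b⟩, h⟩, ha, hl, ⟨⟨c, d⟩, h'⟩, hc, -, hp⟩
    obtain rfl : 0 = a := ha
    obtain rfl : b = c := hc
    exact ⟨b, hl, hp b le_rfl h'⟩
  · rintro ⟨s, hs, hp⟩
    -- The interval `[0, s]` has length `s + 1`, whence the shift by one in the bound.
    refine ⟨⟨(0, s), Nat.zero_le s⟩, rfl, hs, NonemptyInterval.pure s, rfl, ⟨trivial, ?_⟩, ?_⟩
    · rintro ⟨⟨a, b⟩, h⟩ ⟨h1, h2⟩
      change s = a at h1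
      change b < s at h2
      change a ≤ b at h
      omega
    · intro j h1 h2
      obtain rfl : s = j := le_antisymm h1 h2
      exact hp

/-- The Kripke structure that generates the counting traces. -/
def countKripke : Kripke Letter := universalKripke {cell, addrCarry, carry}

/-- Necessity comes from the trace `countTrace n`, whose `$` is as late as possible; sufficiency
holds since every trace satisfying the premise has `$` at that position. -/
theorem mem_V_iff {n : ℕ} (hn : 0 < n) {α : Valuation Unit Empty} :
    α ∈ countKripke.V ((countFormula n).imp (promptly dollar)) ↔
      n * topCell n + 1 ≤ (α (Sum.inl ()) : ℕ) := by
  constructor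
  · intro h
    have h1 := h (countTrace n) (mem_traces_universalKripke (countTrace_zero hn))
    obtain ⟨s, hs, hd⟩ := models_promptly.1 ((HS.sat_imp _ _ _ _ _).1 h1 (sat_countTrace hn))
    have : n * topCell n ≤ s := hd
    omega
  · intro h w _
    exact (HS.sat_imp _ _ _ _ _).2 fun hs => models_promptly.2 ⟨_, h, dollar_of_sat hn hs⟩

theorem inFragment_imp_promptly (n : ℕ) :
    ((countFormula n).imp (promptly dollar)).InFragment {Modality.A, Modality.B} := by
  refine ⟨inFragment_pnf (inFragment_countFormula n) _, ?_⟩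
  simp [promptly, PHS.InFragment, PHS.len]

/-! ### Doubly exponential bounds on the threshold. -/

theorem le_mul_topCell {n : ℕ} (hn : 0 < n) : 2 ^ 2 ^ n ≤ n * topCell n + 1 := by
  have h2 : 2 ≤ 2 ^ n := Nat.le_self_pow hn.ne' 2
  have h3 : 2 ^ 2 ^ n = 2 * 2 ^ (2 ^ n - 1) := by
    rw [← pow_succ', Nat.sub_add_cancel (by omega)]
  -- The number `2 ^ n` of cells per value makes up for the factor two lost in the exponent.
  have h4 : 2 * 2 ^ (2 ^ n - 1) ≤ 2 ^ n * 2 ^ (2 ^ n - 1) := Nat.mul_le_mul_right _ h2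
  have h5 : 1 * topCell n ≤ n * topCell n := Nat.mul_le_mul_right _ hn
  unfold topCell at *
  omega

theorem mul_topCell_le {n : ℕ} (hn : 0 < n) : n * topCell n + 1 ≤ 2 ^ 2 ^ (3 * n) := by
  have h1 : n < 2 ^ n := Nat.lt_two_pow_self
  have h2 : 2 ≤ 2 ^ n := Nat.le_self_pow hn.ne' 2
  have h3 : 2 ^ n < 2 ^ 2 ^ n := Nat.lt_two_pow_self
  have h4 : 2 ^ (2 ^ n - 1) + 1 ≤ 2 ^ 2 ^ n :=
    Nat.pow_lt_pow_right (by norm_num) (by omega)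
  have h5 : topCell n + 1 ≤ 2 ^ 2 ^ n * 2 ^ 2 ^ n := by
    calc topCell n + 1 = 2 ^ n * (2 ^ (2 ^ n - 1) + 1) := by
          rw [topCell, mul_add, mul_one]
          omega
      _ ≤ _ := Nat.mul_le_mul h3.le h4
  -- The factors `n`, `2 ^ n` and `2 ^ (2 ^ n - 1) + 1` are each at most `2 ^ 2 ^ n`, which gives `c
  -- = 3`.
  calc n * topCell n + 1 ≤ (2 ^ 2 ^ n) * (topCell n + 1) := by nlinarith
    _ ≤ 2 ^ 2 ^ n * (2 ^ 2 ^ n * 2 ^ 2 ^ n) := Nat.mul_le_mul_left _ h5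
    _ = 2 ^ (3 * 2 ^ n) := by rw [← pow_add, ← pow_add]; congr 1; ring
    _ ≤ 2 ^ 2 ^ (3 * n) := by
      refine Nat.pow_le_pow_right (by norm_num) ?_
      calc 3 * 2 ^ n ≤ (2 ^ n * 2 ^ n) * 2 ^ n := by gcongr; nlinarith
        _ = 2 ^ (3 * n) := by rw [← pow_add, ← pow_add]; congr 1; ring

end ParamHS

theorem mainTheorem6 :
    ∃ (AP : Type) (_ : Finite AP) (dollar : AP) (K : Kripke AP)
      (ψ : ℕ → HS AP) (φ : ℕ → PHS AP Unit Empty),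
      (∀ n : ℕ, 1 ≤ n →
        (ψ n).InFragment {Modality.A, Modality.B} ∧
        φ n = (ψ n).imp
          (PHS.diaUpper Modality.A UpperCmp.le ()
            (PHS.dia Modality.A (PHS.and (PHS.len 1) (PHS.prop dollar)))) ∧
        (φ n).InFragment {Modality.A, Modality.B}) ∧
      (∃ P : Polynomial ℕ, ∀ n : ℕ, 1 ≤ n → (φ n).size ≤ P.eval n) ∧
      (∃ c : ℕ, ∀ n : ℕ, 1 ≤ n →
        (K.V (φ n)).Nonempty ∧
        ∃ α : Valuation Unit Empty, IsLeast (K.V (φ n)) α ∧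
          2 ^ (2 ^ n) ≤ (α (Sum.inl ()) : ℕ) ∧
          (α (Sum.inl ()) : ℕ) ≤ 2 ^ (2 ^ (c * n))) := by
  refine ⟨Letter, inferInstance, .dollar, countKripke, countFormula,
    fun n => (countFormula n).imp (promptly .dollar), fun n _ =>
      ⟨inFragment_countFormula n, rfl, inFragment_imp_promptly n⟩, ?_, 3, fun n hn => ?_⟩
  · refine ⟨1000 * (Polynomial.X + 1) ^ 2 +
      Polynomial.C (promptly Letter.dollar).size + 1, fun n _ => ?_⟩
    have h1 := HS.size_imp_le (countFormula n) (promptly Letter.dollar)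
    have h2 := nodes_countFormula_le n
    simp
    omega
  -- The successor is the `+ 1` of `mem_V_iff`, and makes the value positive.
  · let α : Valuation Unit Empty := fun _ => (n * topCell n).succPNat
    have hα : IsLeast (countKripke.V ((countFormula n).imp (promptly Letter.dollar))) α := by
      refine ⟨(mem_V_iff hn).2 le_rfl, fun β hβ => ?_⟩
      rintro (⟨⟩ | ⟨⟨⟩⟩)
      exact (mem_V_iff hn).1 hβ
    exact ⟨⟨α, hα.1⟩, α, hα, le_mul_topCell hn, mul_topCell_le hn⟩
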